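/- Let $F$ be a field of characteristic $0$, let $H$ be a Hopf algebra over $F$ (of arbitrary dimension), and let $A=F[x]/(x^2)$ be endowed with the structure of a unital $H$-module algebra, i.e. $A$ is a left $H$-module with $h(ab)=(h_{(1)}a)(h_{(2)}b)$ and $h1_A=\varepsilon(h)1_A$ for all $h\in H$, $a,b\in A$. Let $d$ be the dimension over $F$ of the maximal $H$-invariant nilpotent ideal of $A$. Let $F\langle X|H\rangle=\bigoplus_{n\ge 1}F\langle X\rangle^{(n)}\otimes H^{\otimes n}$ be the free non-unital associative $H$-module algebra on $X=\{x_1,x_2,\dots\}$, where $F\langle X\rangle^{(n)}$ is the space of non-commutative homogeneous polynomials of degree $n$, $h\cdot(v\otimes h_1\otimes\dots\otimes h_n)=v\otimes h_{(1)}h_1\otimes\dots\otimes h_{(n)}h_n$, the product is $(v_1\otimes w_1)(v_2\otimes w_2)=v_1v_2\otimes w_1\otimes w_2$, and $x_{i_1}^{h_1}\cdots x_{i_n}^{h_n}:=x_{i_1}\cdots x_{i_n}\otimes h_1\otimes\dots\otimes h_n$. Let $\mathrm{Id}^H(A)$ be the intersection of the kernels of all $H$-module algebra homomorphisms $F\langle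 X|H\rangle\to A$, let $P_n^H$ be the linear span of all $x_{\sigma(1)}^{h_1}\cdots x_{\sigma(n)}^{h_n}$ with $\sigma\in S_n$, $h_i\in H$, and let $c_n^H(A)=\dim_F\bigl(P_n^H/(P_n^H\cap \mathrm{Id}^H(A))\bigr)$. Then there exist $C_1,C_2>0$ and $r_1,r_2\in\mathbb R$ such that $$C_1n^{r_1}(2-d)^n\le c_n^H(A)\le C_2n^{r_2}(2-d)^n\qquad\text{for all integers } n\ge 1.$$ In particular, Bahturin's analogue of Amitsur's conjecture holds for $A$: the limit $\lim_{n\to\infty}\sqrt[n]{c_n^H(A)}$ exists and is an integer. -/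

import Mathlib

open Polynomial TensorProduct Filter Topology

noncomputable section

namespace HPI

/-! ### Module algebras over a Hopf algebra -/

section ModuleAlgebra

variable {F H A : Type*} [Field F] [Ring H] [HopfAlgebra F H]

/-- A left `H`-module structure `ζ : H → End_F(A)` on a (not necessarily unital) algebra `A` is an
`H`-module algebra structure if `h (a b) = (h₍₁₎ a) (h₍₂₎ b)`. -/
def IsModuleAlgebra [NonUnitalRing A] [Module F A] [IsScalarTower F A A] [SMulCommClass F A A]
    (ζ : H →ₐ[F] Module.End F A) : Prop :=
  ∀ (h : H) (a b : A), ζ h (a * b) =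
    LinearMap.mul' F A (TensorProduct.map (ζ.toLinearMap.flip a) (ζ.toLinearMap.flip b)
      (Coalgebra.comul (R := F) h))

/-- A module algebra structure is unital if moreover `h 1 = ε(h) 1`. -/
structure IsUnitalModuleAlgebra [Ring A] [Algebra F A] (ζ : H →ₐ[F] Module.End F A) : Prop where
  isModuleAlgebra : IsModuleAlgebra ζ
  apply_one : ∀ h : H, ζ h 1 = Coalgebra.counit (R := F) h • (1 : A)

/-- An ideal `I` of `A` is `H`-invariant if `H I ⊆ I`. -/
def IsInvariantIdeal [CommRing A] [Algebra F A] (ζ : H →ₐ[F] Module.End F A) (I : Ideal A) :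
    Prop :=
  ∀ (h : H), ∀ a ∈ I, ζ h a ∈ I

/-- The maximal `H`-invariant nilpotent ideal of a commutative algebra `A`: the supremum of all
`H`-invariant nilpotent ideals. -/
def maxInvariantNilpotentIdeal [CommRing A] [Algebra F A] (ζ : H →ₐ[F] Module.End F A) :
    Ideal A :=
  sSup {I : Ideal A | IsNilpotent I ∧ IsInvariantIdeal ζ I}

/-- If `A` is Noetherian, the ideal above is itself nilpotent and invariant, so that it is indeed
the greatest `H`-invariant nilpotent ideal. -/
theorem isGreatest_maxInvariantNilpotentIdeal [CommRing A] [IsNoetherianRing A] [Algebra F A]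
    (ζ : H →ₐ[F] Module.End F A) :
    IsGreatest {I : Ideal A | IsNilpotent I ∧ IsInvariantIdeal ζ I}
      (maxInvariantNilpotentIdeal ζ) := by
  refine ⟨?_, fun I hI => le_sSup hI⟩
  refine CompleteLattice.WellFoundedGT.isSupClosedCompact (Ideal A) inferInstance _
    ⟨⊥, IsNilpotent.zero, fun h a ha => ?_⟩ ?_
  · rw [Ideal.mem_bot] at ha ⊢
    simp [ha]
  · rintro I ⟨hI, hI'⟩ J ⟨hJ, hJ'⟩
    refine ⟨?_, fun h a ha => ?_⟩
    · rw [← Submodule.add_eq_sup]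
      exact (Commute.all I J).isNilpotent_add hI hJ
    · obtain ⟨x, hx, y, hy, rfl⟩ := Submodule.mem_sup.1 ha
      rw [map_add]
      exact add_mem (Ideal.mem_sup_left (hI' h x hx)) (Ideal.mem_sup_right (hJ' h y hy))

end ModuleAlgebra

/-! ### The free non-unital associative `H`-module algebra `F⟨X | H⟩` -/

section Free

variable (F H : Type*) [Field F] [Ring H] [HopfAlgebra F H]

/-- The tensor algebra of the space `F X ⊗ H` with `X = {x₀, x₁, x₂, …}`; in degree `n` it is
`F⟨X⟩⁽ⁿ⁾ ⊗ H^{⊗ n}`. -/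
abbrev TensorAlg : Type _ := TensorAlgebra F (ℕ →₀ H)

/-- The generator `x_i^h`. -/
def gen : ℕ → H →ₗ[F] TensorAlg F H :=
  fun i => TensorAlgebra.ι F ∘ₗ Finsupp.lsingle i

/-- The diagonal action of `H`, bundled as an algebra homomorphism `t ↦ (h ↦ h t)` into the
convolution algebra `Hom_F(H, TensorAlg F H)`: multiplicativity says that
`h (s t) = (h₍₁₎ s) (h₍₂₎ t)` and `h 1 = ε(h) 1`; on generators `h x_i^k = x_i^{h k}`. -/
def tensorAct : TensorAlg F H →ₐ[F] WithConv (H →ₗ[F] TensorAlg F H) :=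
  TensorAlgebra.lift F (Finsupp.lsum F fun i =>
    (WithConv.linearEquiv F (H →ₗ[F] TensorAlg F H)).symm.toLinearMap ∘ₗ
      (LinearMap.mul F H).flip.compr₂ (gen F H i))

variable {F H}

theorem tensorAct_gen (i : ℕ) (h k : H) : tensorAct F H (gen F H i k) h = gen F H i (h * k) := by
  simp [tensorAct, gen]

theorem tensorAct_mul (s t : TensorAlg F H) (h : H) : tensorAct F H (s * t) h =
    LinearMap.mul' F _ (TensorProduct.map (tensorAct F H s).ofConv (tensorAct F H t).ofConv
      (Coalgebra.comul (R := F) h)) := by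
  rw [map_mul, LinearMap.convMul_apply]

variable (F H)

/-- The free non-unital associative `H`-module algebra `F⟨X | H⟩ = ⨁_{n ≥ 1} F⟨X⟩⁽ⁿ⁾ ⊗ H^{⊗ n}`:
the non-unital subalgebra of the tensor algebra generated by all `x_i^h`. -/
def FreeHAlg : NonUnitalSubalgebra F (TensorAlg F H) :=
  NonUnitalAlgebra.adjoin F {t | ∃ (i : ℕ) (h : H), t = gen F H i h}

instance : AddCommGroup (FreeHAlg F H) := inferInstance

variable {F H}

theorem gen_mem (i : ℕ) (h : H) : gen F H i h ∈ FreeHAlg F H :=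
  NonUnitalAlgebra.subset_adjoin F ⟨i, h, rfl⟩

theorem tensorAct_mem {t : TensorAlg F H} (ht : t ∈ FreeHAlg F H) (h : H) :
    tensorAct F H t h ∈ FreeHAlg F H := by
  induction ht using NonUnitalAlgebra.adjoin_induction generalizing h with
  | mem x hx =>
    obtain ⟨i, k, rfl⟩ := hx
    rw [tensorAct_gen]
    exact gen_mem i _
  | add x y _ _ hx hy => simpa using add_mem (hx h) (hy h)
  | zero => simp
  | mul x y _ _ hx hy =>
    rw [tensorAct_mul]
    induction Coalgebra.comul (R := F) h using TensorProduct.induction_on with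
    | zero => simp
    | tmul a b => simpa using mul_mem (hx a) (hy b)
    | add u v hu hv => simpa using add_mem hu hv
  | smul r x _ hx => simpa using SMulMemClass.smul_mem r (hx h)

theorem tensorAct_one {t : TensorAlg F H} (ht : t ∈ FreeHAlg F H) :
    tensorAct F H t 1 = t := by
  induction ht using NonUnitalAlgebra.adjoin_induction with
  | mem x hx =>
    obtain ⟨i, k, rfl⟩ := hx
    rw [tensorAct_gen, one_mul]
  | add x y _ _ hx hy => simp [hx, hy]
  | zero => simp
  | mul x y _ _ hx hy => simp [Algebra.TensorProduct.one_def, hx, hy]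
  | smul r x _ hx => simp [hx]

theorem tensorAct_mul_apply {t : TensorAlg F H} (ht : t ∈ FreeHAlg F H) (g h : H) :
    tensorAct F H t (g * h) = tensorAct F H (tensorAct F H t h) g := by
  induction ht using NonUnitalAlgebra.adjoin_induction generalizing g h with
  | mem x hx =>
    obtain ⟨i, k, rfl⟩ := hx
    simp only [tensorAct_gen, mul_assoc]
  | add x y _ _ hx hy => simp [hx, hy]
  | zero => simp
  | mul x y _ _ hx hy =>
    rw [tensorAct_mul, tensorAct_mul, Bialgebra.comul_mul]
    induction Coalgebra.comul (R := F) h using TensorProduct.induction_on with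
    | zero => simp
    | add u v hu hv => simp only [mul_add, map_add, hu, hv, WithConv.ofConv_add,
        LinearMap.add_apply]
    | tmul a b =>
      simp only [TensorProduct.map_tmul, LinearMap.mul'_apply]
      rw [tensorAct_mul]
      induction Coalgebra.comul (R := F) g using TensorProduct.induction_on with
      | zero => simp
      | add u v hu hv => simp only [add_mul, map_add, hu, hv]
      | tmul c d => simp [hx, hy]
  | smul r x _ hx => simp [hx]

variable (F H)

/-- The `H`-module algebra structure on `F⟨X | H⟩`. -/
def freeAct : H →ₐ[F] Module.End F (FreeHAlg F H) where
  toFun h :=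
    { toFun := fun t => ⟨tensorAct F H t h, tensorAct_mem t.2 h⟩
      map_add' := fun s t => Subtype.ext (by simp)
      map_smul' := fun r t => Subtype.ext (by simp) }
  map_one' := by ext t; exact tensorAct_one t.2
  map_mul' g h := by ext t; exact tensorAct_mul_apply t.2 g h
  map_zero' := by ext t; simp
  map_add' g h := by ext t; simp
  commutes' r := by ext t; simp [Algebra.algebraMap_eq_smul_one, tensorAct_one t.2]

theorem isModuleAlgebra_freeAct : IsModuleAlgebra (freeAct F H) := by
  intro h a b
  apply Subtype.ext
  change tensorAct F H ((a : TensorAlg F H) * b) h = _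
  rw [tensorAct_mul]
  induction Coalgebra.comul (R := F) h using TensorProduct.induction_on with
  | zero => simp
  | add u v hu hv => simp only [map_add, hu, hv, NonUnitalSubalgebra.coe_add]
  | tmul c d => rfl

end Free

/-! ### Polynomial `H`-identities and codimensions -/

section Codimension

variable {F H A : Type*} [Field F] [Ring H] [HopfAlgebra F H]
  [NonUnitalRing A] [Module F A] [IsScalarTower F A A] [SMulCommClass F A A]

/-- `Id^H(A)`: the intersection of the kernels of all homomorphisms of `H`-module algebras
`F⟨X | H⟩ → A`. -/
def identities (ζ : H →ₐ[F] Module.End F A) : Submodule F (FreeHAlg F H) where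
  carrier := {p | ∀ f : FreeHAlg F H →ₙₐ[F] A,
    (∀ (h : H) (q : FreeHAlg F H), f (freeAct F H h q) = ζ h (f q)) → f p = 0}
  add_mem' hp hq f hf := by rw [map_add, hp f hf, hq f hf, add_zero]
  zero_mem' f _ := map_zero f
  smul_mem' r p hp f hf := by rw [map_smul, hp f hf, smul_zero]

variable (F H) in
/-- `P_n^H`, `n ≥ 1`: the span of the monomials `x_{σ(1)}^{h_1} ⋯ x_{σ(n)}^{h_n}` (the variables
being numbered from `0`). -/
def multilinear (n : ℕ) : Submodule F (FreeHAlg F H) :=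
  Submodule.span F {p | ∃ (σ : Equiv.Perm (Fin n)) (h : Fin n → H),
    (p : TensorAlg F H) = (List.ofFn fun i => gen F H (σ i : ℕ) (h i)).prod}

/-- The codimension `c_n^H(A) = dim (P_n^H / (P_n^H ∩ Id^H(A)))`, `n ≥ 1`. -/
def codim (ζ : H →ₐ[F] Module.End F A) (n : ℕ) : ℕ :=
  Module.finrank F (multilinear F H n ⧸ (identities ζ).submoduleOf (multilinear F H n))

/-- The analogue of Amitsur's conjecture for a given `H`-module algebra `A`: the limit of
`(c_n^H(A))^{1/n}` exists and is an integer. -/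
def AmitsurConjecture (ζ : H →ₐ[F] Module.End F A) : Prop :=
  ∃ k : ℤ, Tendsto (fun n : ℕ => (codim ζ n : ℝ) ^ (1 / (n : ℝ))) atTop (𝓝 (k : ℝ))

end Codimension

end HPI

end

noncomputable section

namespace HPI

/-! ### Evaluations of the free `H`-module algebra -/

section Evaluation

variable {F H A : Type*} [Field F] [Ring H] [HopfAlgebra F H] [CommRing A] [Algebra F A]

/-! Homomorphisms from the free algebra to `A` are evaluations, and `A` is commutative, so for `n ≥
1` the codimension is the dimension of the span of the functions `a ↦ (h₁ a₁) ⋯ (hₙ aₙ)`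
(`codim_eq_finrank_span`). Everything is then decided by the functional sending `h` to the constant
coefficient of `h x`.

If it vanishes, `F x` is invariant and `d = 1`. Every `h` acts diagonally in the basis `1, x`, with
`1 ↦ ε(h) 1`, and `x² = 0` leaves at most one factor `x` in a product: the span has dimension
between `1` and `n + 1`.

If it does not vanish, no nonzero nilpotent ideal is invariant and `d = 0`. Modulo `x`, suitable
elements of `H` read off either coordinate of `a` (`exists_coord`), so their products give `2 ^ n`
independent functions, while multilinearity bounds the dimension by `2 ^ n * 2`. -/

/-- The evaluation `x_i^h ↦ h a_i` of the tensor algebra. -/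
def evalTensor (ζ : H →ₐ[F] Module.End F A) (a : ℕ → A) : TensorAlg F H →ₐ[F] A :=
  TensorAlgebra.lift F (Finsupp.lsum F fun i => ζ.toLinearMap.flip (a i))

theorem evalTensor_gen (ζ : H →ₐ[F] Module.End F A) (a : ℕ → A) (i : ℕ) (h : H) :
    evalTensor ζ a (gen F H i h) = ζ h (a i) := by
  simp [evalTensor, gen]

theorem evalTensor_tensorAct {ζ : H →ₐ[F] Module.End F A} (hζ : IsModuleAlgebra ζ) (a : ℕ → A)
    {t : TensorAlg F H} (ht : t ∈ FreeHAlg F H) (h : H) :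
    evalTensor ζ a (tensorAct F H t h) = ζ h (evalTensor ζ a t) := by
  induction ht using NonUnitalAlgebra.adjoin_induction generalizing h with
  | mem x hx =>
    obtain ⟨i, k, rfl⟩ := hx
    simp [tensorAct_gen, evalTensor_gen]
  | add x y _ _ hx hy => simp [hx, hy]
  | zero => simp
  | mul x y _ _ hx hy =>
    rw [tensorAct_mul, map_mul, hζ]
    induction Coalgebra.comul (R := F) h using TensorProduct.induction_on with
    | zero => simp
    | add u v hu hv => simp only [map_add, hu, hv]
    | tmul c d => simp [hx, hy]
  | smul r x _ hx => simp [hx]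

/-- The evaluation `x_i ↦ a_i`, a homomorphism of `H`-module algebras `F⟨X | H⟩ → A`. -/
def evalFree (ζ : H →ₐ[F] Module.End F A) (a : ℕ → A) : FreeHAlg F H →ₙₐ[F] A :=
  ((evalTensor ζ a : TensorAlg F H →ₙₐ[F] A)).comp (NonUnitalSubalgebraClass.subtype (FreeHAlg F H))

theorem evalFree_apply (ζ : H →ₐ[F] Module.End F A) (a : ℕ → A) (p : FreeHAlg F H) :
    evalFree ζ a p = evalTensor ζ a p := rfl

theorem evalFree_freeAct {ζ : H →ₐ[F] Module.End F A} (hζ : IsModuleAlgebra ζ) (a : ℕ → A)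
    (h : H) (p : FreeHAlg F H) : evalFree ζ a (freeAct F H h p) = ζ h (evalFree ζ a p) :=
  evalTensor_tensorAct hζ a p.2 h

/-- Since `x_i^h = h x_i^1`, equivariance leaves only the images of the `x_i^1` to choose. -/
theorem eq_evalFree {ζ : H →ₐ[F] Module.End F A} (f : FreeHAlg F H →ₙₐ[F] A)
    (hf : ∀ (h : H) (q : FreeHAlg F H), f (freeAct F H h q) = ζ h (f q)) (p : FreeHAlg F H) :
    f p = evalFree ζ (fun i => f ⟨gen F H i 1, gen_mem i 1⟩) p := by
  obtain ⟨t, ht⟩ := p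
  induction ht using NonUnitalAlgebra.adjoin_induction with
  | mem x hx =>
    obtain ⟨i, k, rfl⟩ := hx
    rw [evalFree_apply, evalTensor_gen, ← hf]
    congr 1
    exact Subtype.ext (by simp [freeAct, tensorAct_gen])
  | add x y hx' hy' hx hy =>
    have : (⟨x + y, add_mem hx' hy'⟩ : FreeHAlg F H) = ⟨x, hx'⟩ + ⟨y, hy'⟩ := rfl
    rw [this, map_add, map_add, hx, hy]
  | zero => exact (map_zero f).trans (map_zero _).symm
  | mul x y hx' hy' hx hy =>
    have : (⟨x * y, mul_mem hx' hy'⟩ : FreeHAlg F H) = ⟨x, hx'⟩ * ⟨y, hy'⟩ := rfl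
    rw [this, map_mul, map_mul, hx, hy]
  | smul r x hx' hx =>
    have : (⟨r • x, SMulMemClass.smul_mem r hx'⟩ : FreeHAlg F H) = r • ⟨x, hx'⟩ := rfl
    rw [this, map_smul, map_smul, hx]

theorem mem_identities_iff {ζ : H →ₐ[F] Module.End F A} (hζ : IsModuleAlgebra ζ)
    (p : FreeHAlg F H) : p ∈ identities ζ ↔ ∀ a, evalFree ζ a p = 0 :=
  ⟨fun hp a => hp _ (evalFree_freeAct hζ a), fun hp f hf => by rw [eq_evalFree f hf, hp]⟩

/-- A polynomial as a function of the values of its variables. -/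
def evalFun (ζ : H →ₐ[F] Module.End F A) : FreeHAlg F H →ₗ[F] (ℕ → A) → A :=
  LinearMap.pi fun a => (evalFree ζ a : FreeHAlg F H →ₗ[F] A)

theorem ker_evalFun {ζ : H →ₐ[F] Module.End F A} (hζ : IsModuleAlgebra ζ) :
    LinearMap.ker (evalFun ζ) = identities ζ := by
  ext p
  rw [LinearMap.mem_ker, mem_identities_iff hζ, funext_iff]
  rfl

/-- The function `a ↦ (h₁ a₁) ⋯ (hₙ aₙ)`. -/
def monomialFun (ζ : H →ₐ[F] Module.End F A) {n : ℕ} (h : Fin n → H) (a : ℕ → A) : A :=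
  ∏ i, ζ (h i) (a i)

theorem list_prod_gen_mem {n : ℕ} (hn : n ≠ 0) (i : Fin n → ℕ) (h : Fin n → H) :
    (List.ofFn fun k => gen F H (i k) (h k)).prod ∈ FreeHAlg F H := by
  induction n with
  | zero => exact absurd rfl hn
  | succ n ih =>
    rw [List.ofFn_succ, List.prod_cons]
    rcases eq_or_ne n 0 with rfl | h0
    · simpa using gen_mem _ _
    · exact mul_mem (gen_mem _ _) (ih h0 _ _)

/-- Commutativity of `A` absorbs the permutation: it only relabels the operators `h_i`. -/
theorem map_evalFun_multilinear (ζ : H →ₐ[F] Module.End F A) {n : ℕ} (hn : n ≠ 0) :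
    (multilinear F H n).map (evalFun ζ) =
      Submodule.span F (Set.range (monomialFun ζ (n := n))) := by
  have key (p : FreeHAlg F H) (σ : Equiv.Perm (Fin n)) (h : Fin n → H)
      (hp : (p : TensorAlg F H) = (List.ofFn fun i => gen F H (σ i : ℕ) (h i)).prod) :
      evalFun ζ p = monomialFun ζ (h ∘ σ.symm) := by
    funext a
    change evalTensor ζ a p = ∏ i, ζ (h (σ.symm i)) (a i)
    rw [hp, map_list_prod, List.map_ofFn, List.prod_ofFn,
      ← Equiv.prod_comp σ fun i => ζ (h (σ.symm i)) (a i)]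
    simp [evalTensor_gen]
  rw [multilinear, Submodule.map_span]
  congr 1
  ext g
  constructor
  · rintro ⟨p, ⟨σ, h, hp⟩, rfl⟩
    exact ⟨_, (key p σ h hp).symm⟩
  · rintro ⟨h, rfl⟩
    exact ⟨⟨_, list_prod_gen_mem hn _ h⟩, ⟨1, h, rfl⟩, key _ 1 h rfl⟩

theorem codim_eq_finrank_span {ζ : H →ₐ[F] Module.End F A} (hζ : IsModuleAlgebra ζ) {n : ℕ}
    (hn : n ≠ 0) :
    codim ζ n = Module.finrank F (Submodule.span F (Set.range (monomialFun ζ (n := n)))) := by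
  have hker : (identities ζ).submoduleOf (multilinear F H n) =
      LinearMap.ker ((evalFun ζ).domRestrict (multilinear F H n)) := by
    rw [LinearMap.ker_domRestrict, ker_evalFun hζ, Submodule.submoduleOf]
  rw [codim, hker, LinearEquiv.finrank_eq (LinearMap.quotKerEquivRange _),
    LinearMap.range_domRestrict, map_evalFun_multilinear ζ hn]

end Evaluation

/-! ### The algebra `F[x]/(x²)` -/

section DualNumbers

variable (F : Type*) [Field F]

/-- `F[x]/(x²)` is the algebra of dual numbers. -/
def toDual : AdjoinRoot (X ^ 2 : F[X]) →ₐ[F] DualNumber F :=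
  AdjoinRoot.liftAlgHom _ (Algebra.ofId F _) DualNumber.eps (by simp [pow_two])

/-- The constant coefficient. -/
def coeffZero : AdjoinRoot (X ^ 2 : F[X]) →ₐ[F] F :=
  (TrivSqZeroExt.fstHom F F F).comp (toDual F)

/-- The coefficient of `x`. -/
def coeffOne : AdjoinRoot (X ^ 2 : F[X]) →ₗ[F] F :=
  (TrivSqZeroExt.sndHom F F) ∘ₗ (toDual F).toLinearMap

/-- The class of `x`. -/
abbrev rt : AdjoinRoot (X ^ 2 : F[X]) := AdjoinRoot.root _

theorem toDual_rt : toDual F (rt F) = DualNumber.eps := by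
  simp [toDual]

theorem coeffZero_rt : coeffZero F (rt F) = 0 := by
  simp [coeffZero, toDual_rt]

theorem coeffOne_rt : coeffOne F (rt F) = 1 := by
  simp [coeffOne, toDual_rt]

theorem rt_mul_rt : rt F * rt F = 0 := by
  have h : AdjoinRoot.mk (X ^ 2 : F[X]) (X * X) = 0 := by
    rw [← pow_two]
    exact AdjoinRoot.mk_self
  rwa [map_mul, AdjoinRoot.mk_X] at h

variable {F}

theorem eq_coeff (a : AdjoinRoot (X ^ 2 : F[X])) :
    a = coeffZero F a • 1 + coeffOne F a • rt F := by
  have h : (DualNumber.lift ⟨(Algebra.ofId F _, rt F), rt_mul_rt F, fun r => mul_comm _ _⟩).comp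
      (toDual F) = AlgHom.id F (AdjoinRoot (X ^ 2 : F[X])) := by
    apply AdjoinRoot.algHom_ext
    simp [toDual_rt]
  have := (DFunLike.congr_fun h a).symm
  rw [Algebra.smul_def, Algebra.smul_def, mul_one]
  simpa [DualNumber.lift_apply_apply, coeffZero, coeffOne, Algebra.ofId_apply] using this

theorem coeffZero_eq_zero_of_mem {I : Ideal (AdjoinRoot (X ^ 2 : F[X]))} (hI : IsNilpotent I)
    {a : AdjoinRoot (X ^ 2 : F[X])} (ha : a ∈ I) : coeffZero F a = 0 := by
  obtain ⟨k, hk⟩ := hI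
  have : a ^ k ∈ I ^ k := Ideal.pow_mem_pow ha k
  rw [hk] at this
  have h0 : a ^ k = 0 := by simpa using this
  have h1 : coeffZero F a ^ k = 0 := by rw [← map_pow, h0, map_zero]
  exact eq_zero_of_pow_eq_zero h1

instance : IsNoetherianRing (AdjoinRoot (X ^ 2 : F[X])) :=
  inferInstanceAs (IsNoetherianRing (F[X] ⧸ Ideal.span {(X ^ 2 : F[X])}))

variable {H : Type*} [Ring H] [HopfAlgebra F H]

theorem finrank_maxInvariantNilpotentIdeal_eq_one
    (ζ : H →ₐ[F] Module.End F (AdjoinRoot (X ^ 2 : F[X])))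
    (h0 : ∀ h, coeffZero F (ζ h (rt F)) = 0) :
    Module.finrank F (maxInvariantNilpotentIdeal ζ) = 1 := by
  obtain ⟨⟨hnil, -⟩, hmax⟩ := isGreatest_maxInvariantNilpotentIdeal ζ
  have hrt : rt F ∈ maxInvariantNilpotentIdeal ζ := by
    refine hmax ⟨⟨2, ?_⟩, fun h a ha => ?_⟩ (Ideal.mem_span_singleton_self (rt F))
    · have : rt F ^ 2 = 0 := (pow_two _).trans (rt_mul_rt F)
      rw [Ideal.span_singleton_pow, this]
      simp
    · obtain ⟨b, rfl⟩ := Ideal.mem_span_singleton'.1 ha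
      have hb : coeffZero F (b * rt F) = 0 := by rw [map_mul, coeffZero_rt, mul_zero]
      have h1 : coeffZero F (ζ h (b * rt F)) = 0 := by
        rw [eq_coeff (b * rt F), hb]
        simp [h0]
      rw [eq_coeff (ζ h (b * rt F)), h1, zero_smul, zero_add, Algebra.smul_def]
      exact Ideal.mul_mem_left _ _ (Ideal.mem_span_singleton_self _)
  refine finrank_eq_one (⟨rt F, hrt⟩ : maxInvariantNilpotentIdeal ζ) ?_ fun a => ?_
  · intro h
    have := coeffOne_rt F
    rw [show rt F = 0 from congrArg Subtype.val h, map_zero] at this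
    exact zero_ne_one this
  · refine ⟨coeffOne F a, Subtype.ext ?_⟩
    conv_rhs => rw [eq_coeff (a : AdjoinRoot (X ^ 2 : F[X])), coeffZero_eq_zero_of_mem hnil a.2]
    simp

/-- An element of a nilpotent ideal is `c x`. By invariance `h (c x)` is nilpotent too, so its
constant coefficient, `c` times that of `h x`, is zero, forcing `c = 0`. -/
theorem finrank_maxInvariantNilpotentIdeal_eq_zero
    (ζ : H →ₐ[F] Module.End F (AdjoinRoot (X ^ 2 : F[X]))) {h : H}
    (h0 : coeffZero F (ζ h (rt F)) ≠ 0) :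
    Module.finrank F (maxInvariantNilpotentIdeal ζ) = 0 := by
  obtain ⟨⟨hnil, hinv⟩, -⟩ := isGreatest_maxInvariantNilpotentIdeal ζ
  have hbot (a : maxInvariantNilpotentIdeal ζ) : a = 0 := by
    obtain ⟨a, ha⟩ := a
    have h1 := eq_coeff a
    rw [coeffZero_eq_zero_of_mem hnil ha, zero_smul, zero_add] at h1
    have h2 := coeffZero_eq_zero_of_mem hnil (hinv h a ha)
    rw [h1, map_smul, map_smul, smul_eq_mul, mul_eq_zero, or_iff_left h0] at h2
    rw [h2, zero_smul] at h1
    exact Subtype.ext h1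
  have : Subsingleton (maxInvariantNilpotentIdeal ζ) := ⟨fun a b => by rw [hbot a, hbot b]⟩
  exact Module.finrank_zero_of_subsingleton

/-! ### Bounds for the codimensions -/

theorem prod_add_mul_of_mul_self_eq_zero {ι R : Type*} [DecidableEq ι] [CommRing R]
    {x : R} (hx : x * x = 0) (s : Finset ι) (u v : ι → R) :
    ∏ i ∈ s, (u i + v i * x) = ∏ i ∈ s, u i + ∑ j ∈ s, (v j * ∏ i ∈ s.erase j, u i) * x := by
  induction s using Finset.induction_on with
  | empty => simp
  | insert k s hk ih =>
    rw [Finset.prod_insert hk, ih, Finset.prod_insert hk, Finset.sum_insert hk,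
      Finset.erase_insert hk]
    have : ∑ j ∈ s, (v j * ∏ i ∈ (insert k s).erase j, u i) * x =
        u k * ∑ j ∈ s, (v j * ∏ i ∈ s.erase j, u i) * x := by
      rw [Finset.mul_sum]
      refine Finset.sum_congr rfl fun j hj => ?_
      have hjk : k ≠ j := fun h => hk (h ▸ hj)
      rw [Finset.erase_insert_of_ne hjk, Finset.prod_insert (by simp [hk])]
      ring
    rw [this, ← Finset.sum_mul]
    linear_combination (v k * ∑ j ∈ s, (v j * ∏ i ∈ s.erase j, u i)) * hx

/-- Finite-dimensionality is recorded too: lower bounds by `Submodule.finrank_mono` need it,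
`finrank` being `0` on infinite-dimensional spaces. -/
theorem finrank_span_le_of_subset {V ι κ : Type*} [AddCommGroup V] [Module F V] [Fintype κ]
    {v : ι → V} {w : κ → V} (h : ∀ i, v i ∈ Submodule.span F (Set.range w)) :
    FiniteDimensional F (Submodule.span F (Set.range v)) ∧
      Module.finrank F (Submodule.span F (Set.range v)) ≤ Fintype.card κ := by
  have hle : Submodule.span F (Set.range v) ≤ Submodule.span F (Set.range w) :=
    Submodule.span_le.2 (by rintro _ ⟨i, rfl⟩; exact h i)
  have : FiniteDimensional F (Submodule.span F (Set.range w)) :=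
    FiniteDimensional.span_of_finite F (Set.finite_range w)
  exact ⟨Submodule.finiteDimensional_of_le hle,
    (Submodule.finrank_mono hle).trans (finrank_range_le_card w)⟩

/-- The basis `1, x` of `F[x]/(x²)`. -/
def basisVec (F : Type*) [Field F] (b : Bool) : AdjoinRoot (X ^ 2 : F[X]) :=
  if b then rt F else 1

/-- The coordinates with respect to the basis `1, x`. -/
def coord (F : Type*) [Field F] (b : Bool) : AdjoinRoot (X ^ 2 : F[X]) →ₗ[F] F :=
  if b then coeffOne F else (coeffZero F).toLinearMap

theorem sum_coord (a : AdjoinRoot (X ^ 2 : F[X])) : ∑ b, coord F b a • basisVec F b = a := by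
  conv_rhs => rw [eq_coeff a]
  simp [coord, basisVec, add_comm]

/-- Expanding each argument and the final value in the basis `1, x` gives `n + 1` binary choices. -/
theorem monomialFun_mem_span (ζ : H →ₐ[F] Module.End F (AdjoinRoot (X ^ 2 : F[X]))) {n : ℕ}
    (h : Fin n → H) : monomialFun ζ h ∈ Submodule.span F
      (Set.range fun (s : (Fin n → Bool) × Bool) (a : ℕ → AdjoinRoot (X ^ 2 : F[X])) =>
        (∏ i, coord F (s.1 i) (a i)) • basisVec F s.2) := by
  have : monomialFun ζ h = ∑ s : Fin n → Bool, ∑ b : Bool,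
      coord F b (∏ i, ζ (h i) (basisVec F (s i))) •
        fun a : ℕ → AdjoinRoot (X ^ 2 : F[X]) => (∏ i, coord F (s i) (a i)) • basisVec F b := by
    funext a
    have h1 (i : Fin n) : ζ (h i) (a i) =
        ∑ b, coord F b (a i) • ζ (h i) (basisVec F b) := by
      conv_lhs => rw [← sum_coord (a i)]
      simp only [map_sum, map_smul]
    simp only [monomialFun, h1]
    rw [Finset.prod_univ_sum, Fintype.piFinset_univ, Finset.sum_apply]
    refine Finset.sum_congr rfl fun s _ => ?_
    rw [Finset.prod_smul, Finset.sum_apply]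
    conv_lhs => rw [← sum_coord (∏ i, ζ (h i) (basisVec F (s i)))]
    rw [Finset.smul_sum]
    exact Finset.sum_congr rfl fun b _ => smul_comm _ _ _
  rw [this]
  exact sum_mem fun s _ => sum_mem fun b _ =>
    Submodule.smul_mem _ _ (Submodule.subset_span ⟨(s, b), rfl⟩)

theorem monomialFun_mem_span_of_invariant
    {ζ : H →ₐ[F] Module.End F (AdjoinRoot (X ^ 2 : F[X]))} (hζ : IsUnitalModuleAlgebra ζ)
    (h0 : ∀ h, coeffZero F (ζ h (rt F)) = 0) {n : ℕ} (h : Fin n → H) :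
    monomialFun ζ h ∈ Submodule.span F
      (Set.range fun (s : Option (Fin n)) (a : ℕ → AdjoinRoot (X ^ 2 : F[X])) =>
        s.elim (∏ i : Fin n, algebraMap F _ (coeffZero F (a i))) fun j =>
          (algebraMap F _ (coeffOne F (a j)) *
            ∏ i ∈ Finset.univ.erase j, algebraMap F _ (coeffZero F (a i))) * rt F) := by
  -- The eigenvalues of `h` on `x` and on `1`.
  set γ : H → F := fun h => coeffOne F (ζ h (rt F)) with hγ
  set ε : H → F := fun h => Coalgebra.counit (R := F) h with hε
  have : monomialFun ζ h = (∏ i, ε (h i)) • (fun a : ℕ → AdjoinRoot (X ^ 2 : F[X]) =>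
        ∏ i : Fin n, algebraMap F (AdjoinRoot (X ^ 2 : F[X])) (coeffZero F (a i))) +
      ∑ j, (γ (h j) * ∏ i ∈ Finset.univ.erase j, ε (h i)) •
        fun a : ℕ → AdjoinRoot (X ^ 2 : F[X]) => (algebraMap F _ (coeffOne F (a j)) *
            ∏ i ∈ Finset.univ.erase j, algebraMap F _ (coeffZero F (a i))) * rt F := by
    funext a
    have h1 (i : Fin n) : ζ (h i) (a i) = algebraMap F _ (ε (h i) * coeffZero F (a i)) +
        algebraMap F _ (γ (h i) * coeffOne F (a i)) * rt F := by
      conv_lhs => rw [eq_coeff (a i), map_add, map_smul, map_smul, hζ.apply_one,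
        eq_coeff (ζ (h i) (rt F)), h0]
      simp only [Algebra.smul_def, map_mul, hγ, hε, map_zero]
      ring
    simp only [monomialFun, h1]
    rw [prod_add_mul_of_mul_self_eq_zero (rt_mul_rt F)]
    simp only [Pi.add_apply, Finset.sum_apply, Pi.smul_apply]
    simp only [Algebra.smul_def, map_mul, Finset.prod_mul_distrib, map_prod]
    congr 1
    exact Finset.sum_congr rfl fun j _ => by ring
  rw [this]
  exact add_mem (Submodule.smul_mem _ _ (Submodule.subset_span ⟨none, rfl⟩))
    (sum_mem fun j _ => Submodule.smul_mem _ _ (Submodule.subset_span ⟨some j, rfl⟩))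

theorem codim_le (ζ : H →ₐ[F] Module.End F (AdjoinRoot (X ^ 2 : F[X])))
    (hζ : IsUnitalModuleAlgebra ζ) {n : ℕ} (hn : n ≠ 0) : codim ζ n ≤ 2 ^ n * 2 := by
  rw [codim_eq_finrank_span hζ.1 hn]
  exact (finrank_span_le_of_subset (monomialFun_mem_span ζ)).2.trans (by simp)

theorem codim_le_of_invariant {ζ : H →ₐ[F] Module.End F (AdjoinRoot (X ^ 2 : F[X]))}
    (hζ : IsUnitalModuleAlgebra ζ) (h0 : ∀ h, coeffZero F (ζ h (rt F)) = 0) {n : ℕ} (hn : n ≠ 0) :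
    codim ζ n ≤ n + 1 := by
  rw [codim_eq_finrank_span hζ.1 hn]
  exact (finrank_span_le_of_subset (monomialFun_mem_span_of_invariant hζ h0)).2.trans (by simp)

theorem card_le_codim {ζ : H →ₐ[F] Module.End F (AdjoinRoot (X ^ 2 : F[X]))}
    (hζ : IsUnitalModuleAlgebra ζ) {n : ℕ} (hn : n ≠ 0) {κ : Type*} [Fintype κ]
    (h : κ → Fin n → H) (hli : LinearIndependent F fun k => monomialFun ζ (h k)) :
    Fintype.card κ ≤ codim ζ n := by
  rw [codim_eq_finrank_span hζ.1 hn, ← finrank_span_eq_card hli]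
  have := (finrank_span_le_of_subset (monomialFun_mem_span ζ (n := n))).1
  exact Submodule.finrank_mono (Submodule.span_mono (by rintro _ ⟨k, rfl⟩; exact ⟨_, rfl⟩))

theorem one_le_codim {ζ : H →ₐ[F] Module.End F (AdjoinRoot (X ^ 2 : F[X]))}
    (hζ : IsUnitalModuleAlgebra ζ) {n : ℕ} (hn : n ≠ 0) : 1 ≤ codim ζ n := by
  refine (card_le_codim hζ hn (fun (_ : Unit) _ => 1) ?_)
  -- The product of all the variables is nonzero: it takes the value `1` when every variable is `1`.
  refine LinearIndependent.of_subsingleton () fun h => ?_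
  have h1 := congrArg (coeffZero F) (congrFun h fun _ => 1)
  simp [monomialFun] at h1

/-- Elements whose action, modulo `x`, sends `a` to its two coordinates. -/
theorem exists_coord {ζ : H →ₐ[F] Module.End F (AdjoinRoot (X ^ 2 : F[X]))}
    (hζ : IsUnitalModuleAlgebra ζ) {h : H} (h0 : coeffZero F (ζ h (rt F)) ≠ 0) :
    ∃ k : Bool → H, ∀ b c, coeffZero F (ζ (k b) (basisVec F c)) = if b = c then 1 else 0 := by
  set β := coeffZero F (ζ h (rt F))
  -- `h - ε(h) 1` kills `1` and sends `x` to `β` modulo `x`; dividing by `β` reads off the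
  -- coefficient of `x`.
  refine ⟨fun b => if b then β⁻¹ • (h - algebraMap F H (Coalgebra.counit (R := F) h)) else 1, ?_⟩
  intro b c
  cases b <;> cases c <;>
    simp [basisVec, hζ.apply_one, coeffZero_rt, Algebra.algebraMap_eq_smul_one, β, h0]

theorem two_pow_le_codim {ζ : H →ₐ[F] Module.End F (AdjoinRoot (X ^ 2 : F[X]))}
    (hζ : IsUnitalModuleAlgebra ζ) {h : H} (h0 : coeffZero F (ζ h (rt F)) ≠ 0) {n : ℕ}
    (hn : n ≠ 0) : 2 ^ n ≤ codim ζ n := by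
  obtain ⟨k, hk⟩ := exists_coord hζ h0
  have hcard : Fintype.card (Fin n → Bool) = 2 ^ n := by simp
  rw [← hcard]
  refine card_le_codim hζ hn (fun s i => k (s i)) ?_
  -- Constant coefficients of the values at all tuples of basis vectors; `Φ` carries the family to
  -- the standard basis. The default `0` is harmless, as variables of index at least `n` do not
  -- occur.
  let Φ : ((ℕ → AdjoinRoot (X ^ 2 : F[X])) → AdjoinRoot (X ^ 2 : F[X])) →ₗ[F]
      ((Fin n → Bool) → F) := LinearMap.pi fun t => (coeffZero F).toLinearMap ∘ₗ
        LinearMap.proj fun i => if hi : i < n then basisVec F (t ⟨i, hi⟩) else 0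
  refine LinearIndependent.of_comp Φ ?_
  have : (Φ ∘ fun s => monomialFun ζ fun i => k (s i)) = Pi.basisFun F (Fin n → Bool) := by
    funext s t
    simp only [Φ, Function.comp_apply, LinearMap.pi_apply, LinearMap.comp_apply,
      LinearMap.proj_apply, AlgHom.toLinearMap_apply, monomialFun, Fin.is_lt, dite_true, Fin.eta,
      map_prod, hk, Pi.basisFun_apply]
    rw [Finset.prod_ite_zero]
    simp [Pi.single_apply, funext_iff, eq_comm]
  rw [this]
  exact (Pi.basisFun F _).linearIndependent

end DualNumbers

/-! ### Exponential growth -/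

theorem tendsto_rpow_one_div_of_bounds {c : ℕ → ℝ} {C₁ C₂ r₁ r₂ D : ℝ} (hC₁ : 0 < C₁)
    (hC₂ : 0 < C₂) (hD : 0 ≤ D) (hc : ∀ n : ℕ, 1 ≤ n →
      C₁ * (n : ℝ) ^ r₁ * D ^ n ≤ c n ∧ c n ≤ C₂ * (n : ℝ) ^ r₂ * D ^ n) :
    Tendsto (fun n : ℕ => c n ^ (1 / (n : ℝ))) atTop (𝓝 D) := by
  -- `C ^ (1/n)` and `n ^ (r/n)` both tend to `1`, so constants and polynomial factors do not affect
  -- the limit.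
  have hlim (C r : ℝ) (hC : 0 < C) : Tendsto
      (fun n : ℕ => (C * (n : ℝ) ^ r * D ^ n) ^ (1 / (n : ℝ))) atTop (𝓝 D) := by
    have h1 : Tendsto (fun n : ℕ => C ^ (1 / (n : ℝ))) atTop (𝓝 1) := by
      have := (Real.continuousAt_const_rpow (a := C) (b := 0) hC.ne').tendsto.comp
        tendsto_one_div_atTop_nhds_zero_nat
      rwa [Real.rpow_zero] at this
    have h2 : Tendsto (fun n : ℕ => ((n : ℝ) ^ (1 / (n : ℝ))) ^ r) atTop (𝓝 1) := by
      have := (tendsto_rpow_div.comp tendsto_natCast_atTop_atTop).rpow_const (p := r)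
        (Or.inl one_ne_zero)
      simpa using this
    have h3 := (h1.mul h2).mul_const D
    rw [one_mul, one_mul] at h3
    refine h3.congr' ?_
    filter_upwards [eventually_ge_atTop 1] with n hn
    have hn0 : (n : ℝ) ≠ 0 := by positivity
    rw [Real.mul_rpow (by positivity) (by positivity), Real.mul_rpow hC.le (by positivity),
      ← Real.rpow_mul (by positivity), ← Real.rpow_mul (by positivity), mul_comm r,
      ← Real.rpow_natCast, ← Real.rpow_mul hD, mul_one_div_cancel hn0, Real.rpow_one]
  refine tendsto_of_tendsto_of_tendsto_of_le_of_le' (hlim C₁ r₁ hC₁) (hlim C₂ r₂ hC₂) ?_ ?_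
  · filter_upwards [eventually_ge_atTop 1] with n hn
    exact Real.rpow_le_rpow (by positivity) (hc n hn).1 (by positivity)
  · filter_upwards [eventually_ge_atTop 1] with n hn
    exact Real.rpow_le_rpow (le_trans (by positivity) (hc n hn).1) (hc n hn).2 (by positivity)

end HPI

end

theorem mainTheorem9 {F : Type*} [Field F] [CharZero F] {H : Type*} [Ring H] [HopfAlgebra F H]
    (ζ : H →ₐ[F] Module.End F (AdjoinRoot (X ^ 2 : F[X])))
    (hζ : HPI.IsUnitalModuleAlgebra ζ)
    (d : ℕ) (hd : d = Module.finrank F (HPI.maxInvariantNilpotentIdeal ζ)) :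
    (∃ C₁ C₂ r₁ r₂ : ℝ, 0 < C₁ ∧ 0 < C₂ ∧ ∀ n : ℕ, 1 ≤ n →
      C₁ * (n : ℝ) ^ r₁ * (2 - (d : ℝ)) ^ n ≤ (HPI.codim ζ n : ℝ) ∧
      (HPI.codim ζ n : ℝ) ≤ C₂ * (n : ℝ) ^ r₂ * (2 - (d : ℝ)) ^ n) ∧
    HPI.AmitsurConjecture ζ := by
  have hmain : (d : ℝ) ≤ 2 ∧ ∃ C₁ C₂ r₁ r₂ : ℝ, 0 < C₁ ∧ 0 < C₂ ∧ ∀ n : ℕ, 1 ≤ n →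
      C₁ * (n : ℝ) ^ r₁ * (2 - (d : ℝ)) ^ n ≤ (HPI.codim ζ n : ℝ) ∧
      (HPI.codim ζ n : ℝ) ≤ C₂ * (n : ℝ) ^ r₂ * (2 - (d : ℝ)) ^ n := by
    by_cases h0 : ∀ h, HPI.coeffZero F (ζ h (HPI.rt F)) = 0
    · rw [HPI.finrank_maxInvariantNilpotentIdeal_eq_one ζ h0] at hd
      subst hd
      -- Here `1 ≤ c_n ≤ n + 1 ≤ 2 n`.
      refine ⟨by norm_num, 1, 2, 0, 1, one_pos, two_pos, fun n hn => ?_⟩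
      have hn' : n ≠ 0 := by omega
      have h1 : (1 : ℝ) ≤ HPI.codim ζ n := by exact_mod_cast HPI.one_le_codim hζ hn'
      have h2 : (HPI.codim ζ n : ℝ) ≤ n + 1 := by
        exact_mod_cast HPI.codim_le_of_invariant hζ h0 hn'
      have h3 : (1 : ℝ) ≤ n := by exact_mod_cast hn
      have h4 : (2 : ℝ) - ((1 : ℕ) : ℝ) = 1 := by norm_num
      rw [h4, one_pow, Real.rpow_zero, Real.rpow_one]
      constructor <;> linarith
    · obtain ⟨h, h0⟩ := not_forall.1 h0
      rw [HPI.finrank_maxInvariantNilpotentIdeal_eq_zero ζ h0] at hd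
      subst hd
      refine ⟨by norm_num, 1, 2, 0, 0, one_pos, two_pos, fun n hn => ?_⟩
      have hn' : n ≠ 0 := by omega
      have h1 : (2 : ℝ) ^ n ≤ HPI.codim ζ n := by exact_mod_cast HPI.two_pow_le_codim hζ h0 hn'
      have h2 : (HPI.codim ζ n : ℝ) ≤ 2 ^ n * 2 := by exact_mod_cast HPI.codim_le ζ hζ hn'
      rw [Nat.cast_zero, sub_zero, Real.rpow_zero]
      constructor <;> linarith
  obtain ⟨hd2, C₁, C₂, r₁, r₂, hC₁, hC₂, hc⟩ := hmain
  refine ⟨⟨C₁, C₂, r₁, r₂, hC₁, hC₂, hc⟩, 2 - d, ?_⟩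
  push_cast
  exact HPI.tendsto_rpow_one_div_of_bounds hC₁ hC₂ (sub_nonneg.2 hd2) hc
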